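/- For a word $x$ of length $n$ over an alphabet $\Sigma$, let $A_N(x)$ (nondeterministic automatic complexity) be the minimal number of states of a nondeterministic finite automaton $M$ over $\Sigma$, with a single initial state and without $\varepsilon$-transitions, such that $M$ accepts $x$ and $M$ has only one accepting path of length $n$ (a path being a sequence of consecutive labelled edges, starting in the initial state and ending in a final state). Let $A(x)$ (automatic complexity) be the minimal number of states of a deterministic finite automaton (with total transition function) for which $x$ is the only accepted word of length $n$. A set $S\subseteq\{0,1\}^*$ is said to contain almost all $x\in\{0,1\}^n$ if $\lim_{n\to\infty}|S\cap\{0,1\}^n|/2^n=1$. **Theorem 5.1.** For almost all binary words $x$, $A_N(x)/(n/2)\to 1$. That is, for all $\epsilon>0$ there is an $n_0$ such that for all $n\ge n_0$, if $x\in\{0,1\}^n$ is chosen uniformly at random, then $$\left|\frac{A_N(x)}{n/2}-1\right|<\epsilon$$ with probability at least $1-\epsilon$. More precisely, for every real $d>2$, $$A_N(x)\ \ge\ \frac{n+1}{2}-\frac12\,(d\log_2 n)^2$$ for almost all $x\in\{0,1\}^n$. Moreover, for every $\epsilon>0$, $A(x)\ge n/(2+\epsilon)$ for almost all $x\in\{0,1\}^n$.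 This improves the bound $A(x)\ge n/13$, for almost all $x$, of Shallit and Wang. -/

import Mathlib

open Filter Topology

/-- `s` is an accepting path of length `n` of the nondeterministic automaton `M`, labelled by the
word `w`: it starts in an initial state, its `i`-th edge reads the letter `w i`, and it ends in a
final state. -/
def NFA.IsAcceptingPath {α σ : Type*} (M : NFA α σ) {n : ℕ} (w : Fin n → α)
    (s : Fin (n + 1) → σ) : Prop :=
  s 0 ∈ M.start ∧ (∀ i : Fin n, s i.succ ∈ M.step (s i.castSucc) (w i)) ∧
    s (Fin.last n) ∈ M.accept

/-- `M` has a single initial state, `M` accepts `x`, and `M` has only one accepting path of the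
length of `x`. Paths are sequences of labelled edges, so a second label on an edge of the
path would give a second accepting path. -/
def NFA.UniquelyAccepts {α σ : Type*} (M : NFA α σ) {n : ℕ} (x : Fin n → α) : Prop :=
  (∃ q₀ : σ, M.start = {q₀}) ∧
    ∃ s : Fin (n + 1) → σ, M.IsAcceptingPath x s ∧
      ∀ (w : Fin n → α) (t : Fin (n + 1) → σ), M.IsAcceptingPath w t → w = x ∧ t = s

/-- The nondeterministic automatic complexity `A_N(x)`: the minimal number of states of a
nondeterministic finite automaton that accepts `x` and has only one accepting path of the
length of `x`. -/
noncomputable def nondetAutomaticComplexity {α : Type*} {n : ℕ} (x : Fin n → α) : ℕ :=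
  sInf {q : ℕ | ∃ M : NFA α (Fin q), M.UniquelyAccepts x}

/-- The (deterministic) automatic complexity `A(x)`: the minimal number of states of a
deterministic finite automaton for which `x` is the only accepted word of its length. -/
noncomputable def automaticComplexity {α : Type*} {n : ℕ} (x : Fin n → α) : ℕ :=
  sInf {q : ℕ | ∃ M : DFA α (Fin q), ∀ w : Fin n → α, List.ofFn w ∈ M.accepts ↔ w = x}

/-- The probability that a uniformly random binary word of length `n` lies in `S`. -/
noncomputable def wordProb {n : ℕ} (S : Set (Fin n → Bool)) : ℝ :=
  (S.ncard : ℝ) / 2 ^ n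

/-- A set of binary words (given by its part `S n` in each length `n`) contains almost all binary
words of length `n`: its proportion among the words of length `n` tends to `1` as `n → ∞`. -/
def ContainsAlmostAll (S : (n : ℕ) → Set (Fin n → Bool)) : Prop :=
  Tendsto (fun n : ℕ => wordProb (S n)) atTop (𝓝 1)

/-!
Lower bound. Suppose an automaton with `q` states accepts `x`, of length `n`, by a unique path of
length `n`. Cutting the path at visits of the same state and putting the pieces together to another
path of length `n` must give the same labelled path back. Two consequences carry the argument.

* If the path returns to a state after `ℓ` steps at time `u`, and does so again (to a possibly
  different state) at time `t > u`, then the first closed walk can be doubled and the last one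
  omitted, which delays the path by `ℓ` between `u` and `t`. So `x` has period `ℓ` there, and its
  factor of length `t - u` ending at `t` recurs `ℓ` letters earlier
  (`IsRigidWalk.lt_add_of_return`).
* The closed walks between three consecutive visits of a state can be interchanged, so they have
  the same length `ℓ` (`IsRigidWalk.gaps_eq`).

Let `m` be such that no factor of length `m` occurs twice in `x`. A time `t` at which a state is
visited for at least the third time then comes with a gap `0 < ℓ < m`, and for each `ℓ` there are
fewer than `m` such times. All other times number at most `2 * q`, so
`n + 1 ≤ 2 * q + (m - 1) ^ 2` (`IsRigidWalk.card_le`). By a union bound over the pairs of positions,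
a random binary word repeats a factor of length `m` with probability at most `n ^ 2 / 2 ^ m`, which
tends to `0` for `m = ⌊d * log₂ n⌋ + 1` with `d > 2` (`containsAlmostAll_not_hasRepeat`).

Upper bound. The path that goes through `0, 1, …, ⌊n / 2⌋`, uses a loop once and goes back is the
only one of its length in the automaton formed by its edges (`exists_nfa_uniquelyAccepts`).

A deterministic automaton whose only accepted word of length `n` is `x` is also a nondeterministic
one with a unique accepting path of length `n`, so the lower bound passes to `A(x)`.
-/

/-! ### Rerouting a unique accepting path -/

/-- The word `x` contains the same factor of length `m` at two positions `i` and `i + ℓ` with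
`ℓ > 0`; the two occurrences may overlap. -/
def HasRepeat {α : Type*} {n : ℕ} (x : Fin n → α) (m : ℕ) : Prop :=
  ∃ i ℓ : ℕ, 0 < ℓ ∧ i + ℓ + m ≤ n ∧
    ∀ a b : Fin n, i ≤ a → (a : ℕ) < i + m → (b : ℕ) = a + ℓ → x a = x b

/-- The walk `s 0, …, s n` with edge labels `x` is determined by its edges: whenever edges of the
walk (the `g i`-th one at time `i`) are put together to a walk of length `n` with the same end
points, the result is the original labelled walk. The values of `s` beyond `n` play no role. -/
def IsRigidWalk {α σ : Type*} {n : ℕ} (x : Fin n → α) (s : ℕ → σ) : Prop :=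
  ∀ g : ℕ → ℕ, (∀ i < n, g i < n) → s (g 0) = s 0 → s (g n) = s n →
    (∀ i < n, s (g i + 1) = s (g (i + 1))) →
      (∀ i ≤ n, s (g i) = s i) ∧ ∀ a b : Fin n, (b : ℕ) = g a → x b = x a

theorem NFA.UniquelyAccepts.exists_isRigidWalk {α σ : Type*} {n : ℕ} {M : NFA α σ}
    {x : Fin n → α} (h : M.UniquelyAccepts x) : ∃ s : ℕ → σ, IsRigidWalk x s := by
  obtain ⟨-, s, ⟨h0, hstep, hacc⟩, huniq⟩ := h
  have hval : ∀ i : Fin (n + 1), s (Fin.ofNat (n + 1) i) = s i := fun i => by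
    congr 1; ext; simp [Fin.ofNat, Nat.mod_eq_of_lt i.isLt]
  refine ⟨fun i => s (Fin.ofNat (n + 1) i), fun g hg hg0 hgn hcomp => ?_⟩
  have hpath : M.IsAcceptingPath (fun i : Fin n => x ⟨g i, hg i i.isLt⟩)
      (fun i : Fin (n + 1) => s (Fin.ofNat (n + 1) (g i))) := by
    refine ⟨?_, fun i => ?_, ?_⟩
    · have := hval 0
      simp only [Fin.val_zero] at this hg0 ⊢
      rw [hg0, this]; exact h0
    · have h1 := hstep ⟨g i, hg i i.isLt⟩
      have h2 := hval (Fin.succ ⟨g i, hg i i.isLt⟩)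
      have h3 := hval (Fin.castSucc ⟨g i, hg i i.isLt⟩)
      have h4 := hcomp i i.isLt
      simp only [Fin.val_succ, Fin.val_castSucc] at h2 h3 h4 ⊢
      rw [← h4, h2, h3]; exact h1
    · have := hval (Fin.last n)
      simp only [Fin.val_last] at this hgn ⊢
      rw [hgn, this]; exact hacc
  obtain ⟨hw, ht⟩ := huniq _ _ hpath
  refine ⟨fun i hi => ?_, fun a b hb => ?_⟩
  · have h1 := congrFun ht ⟨i, by omega⟩
    have h2 := hval ⟨i, by omega⟩
    exact h1.trans h2.symm
  · rw [← congrFun hw a]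
    congr 1; ext; exact hb

/-- Two returns with the same delay `ℓ`, at times `u ≤ t`: inserting the first closed walk and
omitting the last one delays the walk by `ℓ` between `u` and `t`, so the labels have period `ℓ`
there. -/
theorem IsRigidWalk.lt_add_of_return {α σ : Type*} {n m ℓ u t : ℕ} {x : Fin n → α} {s : ℕ → σ}
    (hs : IsRigidWalk x s) (hx : ¬ HasRepeat x m) (hℓ : 0 < ℓ) (hu : ℓ ≤ u) (htn : t ≤ n)
    (hsu : s (u - ℓ) = s u) (hst : s (t - ℓ) = s t) : t < u + m := by
  by_contra! htu
  obtain ⟨-, hlab⟩ := hs (fun i => if u ≤ i ∧ i < t then i - ℓ else i)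
    (fun i hi => by split_ifs <;> omega)
    (by rw [if_neg (by omega)]) (by rw [if_neg (by omega)])
    (fun i hi => by
      by_cases h1 : u ≤ i ∧ i < t
      · rw [if_pos h1]
        by_cases h2 : i + 1 < t
        · rw [if_pos (by omega)]; congr 1; omega
        · rw [if_neg (by omega)]
          obtain rfl : t = i + 1 := by omega
          rw [← hst]; congr 1; omega
      · rw [if_neg h1]
        by_cases h2 : i + 1 = u ∧ u < t
        · rw [if_pos (by omega)]
          obtain ⟨rfl, -⟩ := h2
          exact hsu.symm
        · rw [if_neg (by omega)])
  refine hx ⟨u - ℓ, ℓ, hℓ, by omega, fun a b ha ham hb => hlab b a ?_⟩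
  rw [if_pos (by omega)]; omega

/-- Interchanging the closed walks between three consecutive visits of a state gives the same walk
only if the two closed walks have the same length. -/
theorem IsRigidWalk.gaps_eq {α σ : Type*} {n t₀ t₁ t₂ : ℕ} {x : Fin n → α} {s : ℕ → σ}
    (hs : IsRigidWalk x s) (h01 : t₀ < t₁) (h12 : t₁ < t₂) (h2n : t₂ ≤ n)
    (hs01 : s t₀ = s t₁) (hs12 : s t₁ = s t₂)
    (hv01 : ∀ v, t₀ < v → v < t₁ → s v ≠ s t₁) (hv12 : ∀ v, t₁ < v → v < t₂ → s v ≠ s t₂) :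
    t₁ - t₀ = t₂ - t₁ := by
  set a := t₁ - t₀ with ha
  set b := t₂ - t₁ with hb
  obtain ⟨hst, -⟩ := hs
    (fun i => if t₀ ≤ i ∧ i < t₀ + b then i + a else if t₀ + b ≤ i ∧ i < t₂ then i - b else i)
    (fun i hi => by split_ifs <;> omega)
    (by
      by_cases h : t₀ = 0
      · rw [if_pos (by omega), show 0 + a = t₁ by omega, ← hs01, h]
      · rw [if_neg (by omega), if_neg (by omega)])
    (by rw [if_neg (by omega), if_neg (by omega)])
    (fun i hi => by
      by_cases h1 : t₀ ≤ i ∧ i < t₀ + b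
      · rw [if_pos h1]
        by_cases h2 : i + 1 < t₀ + b
        · rw [if_pos (by omega)]; congr 1; omega
        · rw [if_neg (by omega), if_pos (by omega), show i + a + 1 = t₂ by omega,
            show i + 1 - b = t₀ by omega, hs01, hs12]
      · rw [if_neg h1]
        by_cases h2 : t₀ + b ≤ i ∧ i < t₂
        · rw [if_pos h2, if_neg (by omega)]
          by_cases h3 : i + 1 < t₂
          · rw [if_pos (by omega)]; congr 1; omega
          · rw [if_neg (by omega), show i - b + 1 = t₁ by omega, show i + 1 = t₂ by omega, hs12]
        · rw [if_neg h2]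
          by_cases h3 : i + 1 = t₀
          · rw [if_pos (by omega), h3, show t₀ + a = t₁ by omega, hs01]
          · rw [if_neg (by omega), if_neg (by omega)])
  rcases lt_trichotomy a b with hab | hab | hab
  · have := hst (t₀ + a) (by omega)
    rw [if_pos (by omega)] at this
    refine absurd ?_ (hv12 (t₀ + a + a) (by omega) (by omega))
    rw [this, show t₀ + a = t₁ by omega, hs12]
  · exact hab
  · have := hst (t₀ + b) (by omega)
    rw [if_neg (by omega), if_pos (by omega)] at this
    refine absurd ?_ (hv01 (t₀ + b) (by omega) (by omega))
    rw [← this, show t₀ + b - b = t₀ by omega, hs01]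

theorem exists_last_visit {σ : Type*} {s : ℕ → σ} {t u : ℕ} (hu : u < t) (hsu : s u = s t) :
    ∃ v, u ≤ v ∧ v < t ∧ s v = s t ∧ ∀ w, v < w → w < t → s w ≠ s t := by
  classical
  have hne : ((Finset.range t).filter fun v => s v = s t).Nonempty := ⟨u, by simp [hu, hsu]⟩
  have hmem := Finset.max'_mem _ hne
  simp only [Finset.mem_filter, Finset.mem_range] at hmem
  refine ⟨_, Finset.le_max' _ u (by simp [hu, hsu]), hmem.1, hmem.2, fun w hw hwt hsw => ?_⟩
  exact absurd (Finset.le_max' _ w (by simp [hwt, hsw])) (not_le.mpr hw)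

/-- The state at time `t` is visited at least three times up to time `t`. -/
def IsThirdVisit {σ : Type*} (s : ℕ → σ) (t : ℕ) : Prop :=
  ∃ t₀ t₁, t₀ < t₁ ∧ t₁ < t ∧ s t₀ = s t ∧ s t₁ = s t

theorem IsRigidWalk.exists_period {α σ : Type*} {n m t : ℕ} {x : Fin n → α} {s : ℕ → σ}
    (hs : IsRigidWalk x s) (hx : ¬ HasRepeat x m) (htn : t ≤ n) (ht : IsThirdVisit s t) :
    ∃ ℓ ∈ Finset.Ico 1 m, 2 * ℓ ≤ t ∧ s (t - 2 * ℓ) = s (t - ℓ) ∧ s (t - ℓ) = s t := by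
  obtain ⟨u, u', huu, hu't, hsu, hsu'⟩ := ht
  obtain ⟨t₁, hut₁, ht₁, hst₁, hv⟩ := exists_last_visit hu't hsu'
  obtain ⟨t₀, -, ht₀, hst₀, hv'⟩ := exists_last_visit (s := s) (huu.trans_le hut₁)
    (hsu.trans hst₁.symm)
  have hgap := hs.gaps_eq ht₀ ht₁ htn hst₀ hst₁ hv' hv
  have e1 : t - (t - t₁) = t₁ := by omega
  have e0 : t₁ - (t - t₁) = t₀ := by omega
  have hlt := hs.lt_add_of_return (u := t₁) (t := t) (ℓ := t - t₁) hx (by omega) (by omega) htn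
    (by rw [e0, hst₀]) (by rw [e1, hst₁])
  refine ⟨t - t₁, by rw [Finset.mem_Ico]; omega, by omega, ?_, by rw [e1, hst₁]⟩
  rw [e1, show t - 2 * (t - t₁) = t₀ by omega, hst₀]

theorem IsRigidWalk.card_le {α σ : Type*} [Fintype σ] {n m : ℕ} {x : Fin n → α} {s : ℕ → σ}
    (hs : IsRigidWalk x s) (hx : ¬ HasRepeat x m) :
    n + 1 ≤ 2 * Fintype.card σ + (m - 1) ^ 2 := by
  classical
  have hfirst : ((Finset.range (n + 1)).filter fun t => ¬ IsThirdVisit s t).card ≤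
      2 * Fintype.card σ := by
    refine Finset.card_le_mul_card_image_of_maps_to (f := s) (t := Finset.univ)
      (fun _ _ => Finset.mem_univ _) 2 fun q _ => ?_
    by_contra! hcard
    obtain ⟨a, ha, b, hb, c, hc, hab, hac, hbc⟩ := Finset.two_lt_card.mp hcard
    simp only [Finset.mem_filter, Finset.mem_range] at ha hb hc
    obtain ⟨⟨-, ha⟩, hqa⟩ := ha
    obtain ⟨⟨-, hb⟩, hqb⟩ := hb
    obtain ⟨⟨-, hc⟩, hqc⟩ := hc
    have key : ∀ i j k, s i = q → s j = q → s k = q → ¬ IsThirdVisit s k → i < j → ¬ j < k :=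
      fun i j k hi hj hk hk' hij hjk => hk' ⟨i, j, hij, hjk, hi.trans hk.symm, hj.trans hk.symm⟩
    rcases lt_or_gt_of_ne hab with h1 | h1 <;> rcases lt_or_gt_of_ne hac with h2 | h2 <;>
      rcases lt_or_gt_of_ne hbc with h3 | h3 <;> grind
  have hthird : ((Finset.range (n + 1)).filter fun t => IsThirdVisit s t).card ≤ (m - 1) ^ 2 := by
    set B : ℕ → Finset ℕ := fun ℓ => (Finset.range (n + 1)).filter fun t =>
      2 * ℓ ≤ t ∧ s (t - 2 * ℓ) = s (t - ℓ) ∧ s (t - ℓ) = s t with hB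
    have hsub : ((Finset.range (n + 1)).filter fun t => IsThirdVisit s t) ⊆
        (Finset.Ico 1 m).biUnion B := by
      intro t ht
      simp only [Finset.mem_filter, Finset.mem_range] at ht
      obtain ⟨ℓ, hℓ, h⟩ := hs.exists_period hx (by omega) ht.2
      exact Finset.mem_biUnion.mpr ⟨ℓ, hℓ, by simpa [hB, ht.1] using h⟩
    refine (Finset.card_le_card hsub).trans ((Finset.card_biUnion_le_card_mul _ _ (m - 1)
      fun ℓ hℓ => ?_).trans_eq (by rw [Nat.card_Ico, sq]))
    rcases (B ℓ).eq_empty_or_nonempty with hempty | hne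
    · simp [hempty]
    have hℓ1 := (Finset.mem_Ico.mp hℓ).1
    have hmin := Finset.min'_mem _ hne
    set t₀ := (B ℓ).min' hne with ht₀
    simp only [hB, Finset.mem_filter, Finset.mem_range] at hmin
    have : B ℓ ⊆ Finset.Ico t₀ (t₀ + (m - 1)) := by
      intro t ht
      have hle := Finset.min'_le _ t ht
      simp only [hB, Finset.mem_filter, Finset.mem_range] at ht
      -- The state also returns at time `t₀ - ℓ`, which saves one element.
      have := hs.lt_add_of_return (u := t₀ - ℓ) (t := t) hx hℓ1 (by omega) (by omega)
        (by rw [show t₀ - ℓ - ℓ = t₀ - 2 * ℓ by omega]; exact hmin.2.2.1) ht.2.2.2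
      rw [Finset.mem_Ico]
      omega
    simpa using Finset.card_le_card this
  have := Finset.card_filter_add_card_filter_not (s := Finset.range (n + 1))
    (fun t => IsThirdVisit s t)
  rw [Finset.card_range] at this
  omega

/-! ### Counting words with a repeated factor -/

/-- A word in which the factor of length `m` at `i` recurs at `i + ℓ` is determined by its letters
outside the second occurrence. -/
theorem ncard_factor_recurs_mul_le (n m i ℓ : ℕ) :
    {x : Fin n → Bool | 0 < ℓ ∧ i + ℓ + m ≤ n ∧
      ∀ a b : Fin n, i ≤ a → (a : ℕ) < i + m → (b : ℕ) = a + ℓ → x a = x b}.ncard * 2 ^ m ≤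
        2 ^ n := by
  by_cases h : 0 < ℓ ∧ i + ℓ + m ≤ n
  swap
  · simp [← and_assoc, h]
  have hle := Set.ncard_le_ncard_of_injOn (t := Set.univ)
    (s := {x : Fin n → Bool | 0 < ℓ ∧ i + ℓ + m ≤ n ∧
      ∀ a b : Fin n, i ≤ a → (a : ℕ) < i + m → (b : ℕ) = a + ℓ → x a = x b})
    (fun (x : Fin n → Bool) (j : Fin (n - m)) =>
      x ⟨if (j : ℕ) < i + ℓ then j else j + m, by split_ifs <;> omega⟩)
    (fun _ _ => Set.mem_univ _) ?_ Set.finite_univ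
  · rw [Set.ncard_univ, Nat.card_eq_fintype_card, Fintype.card_fun, Fintype.card_bool,
      Fintype.card_fin] at hle
    calc _ ≤ 2 ^ (n - m) * 2 ^ m := Nat.mul_le_mul_right _ hle
      _ = 2 ^ n := by rw [← pow_add]; congr 1; omega
  · rintro x ⟨-, -, hx⟩ y ⟨-, -, hy⟩ hxy
    have key : ∀ (k : ℕ) (hk : k < n), x ⟨k, hk⟩ = y ⟨k, hk⟩ := by
      intro k
      induction k using Nat.strong_induction_on with
      | _ k ih =>
        intro hk
        by_cases h1 : k < i + ℓ
        · have := congrFun hxy ⟨k, by omega⟩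
          simpa [h1] using this
        · by_cases h2 : k < i + ℓ + m
          · rw [← hx ⟨k - ℓ, by omega⟩ ⟨k, hk⟩ (by simp; omega) (by simp; omega) (by simp; omega),
              ← hy ⟨k - ℓ, by omega⟩ ⟨k, hk⟩ (by simp; omega) (by simp; omega) (by simp; omega)]
            exact ih _ (by omega) _
          · have := congrFun hxy ⟨k - m, by omega⟩
            have h3 : ¬ k - m < i + ℓ := by omega
            have h4 : k - m + m = k := by omega
            simpa [h3, h4] using this
    funext k
    exact key k k.isLt

theorem ncard_hasRepeat_mul_le (n m : ℕ) (hm : 0 < m) :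
    {x : Fin n → Bool | HasRepeat x m}.ncard * 2 ^ m ≤ n ^ 2 * 2 ^ n := by
  have hsub : {x : Fin n → Bool | HasRepeat x m} ⊆
      ⋃ p ∈ Finset.range n ×ˢ Finset.range n, {x : Fin n → Bool | 0 < p.2 ∧ p.1 + p.2 + m ≤ n ∧
        ∀ a b : Fin n, p.1 ≤ a → (a : ℕ) < p.1 + m → (b : ℕ) = a + p.2 → x a = x b} := by
    rintro x ⟨i, ℓ, hℓ, hn, hx⟩
    refine Set.mem_biUnion (x := (i, ℓ)) ?_ ⟨hℓ, hn, hx⟩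
    simp only [Finset.coe_product, Finset.coe_range, Set.mem_prod, Set.mem_Iio]
    omega
  calc _ ≤ (∑ p ∈ Finset.range n ×ˢ Finset.range n, _) * 2 ^ m :=
        Nat.mul_le_mul_right _ ((Set.ncard_le_ncard hsub (Set.toFinite _)).trans
          (Finset.set_ncard_biUnion_le _ _))
    _ ≤ ∑ p ∈ Finset.range n ×ˢ Finset.range n, 2 ^ n := by
        rw [Finset.sum_mul]
        exact Finset.sum_le_sum fun p _ => ncard_factor_recurs_mul_le n m p.1 p.2
    _ = n ^ 2 * 2 ^ n := by simp [sq]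

theorem wordProb_mono {n : ℕ} {S T : Set (Fin n → Bool)} (h : S ⊆ T) :
    wordProb S ≤ wordProb T := by
  unfold wordProb
  gcongr
  exact Set.toFinite _

theorem wordProb_compl {n : ℕ} (S : Set (Fin n → Bool)) : wordProb Sᶜ = 1 - wordProb S := by
  have h : (S.ncard : ℝ) + (Sᶜ.ncard : ℝ) = 2 ^ n := by
    have := Set.ncard_add_ncard_compl S
    rw [Nat.card_eq_fintype_card, Fintype.card_fun, Fintype.card_bool, Fintype.card_fin] at this
    exact_mod_cast this
  unfold wordProb
  field_simp
  linarith

theorem wordProb_le_one {n : ℕ} (S : Set (Fin n → Bool)) : wordProb S ≤ 1 := by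
  have h : 0 ≤ wordProb Sᶜ := by unfold wordProb; positivity
  rw [wordProb_compl] at h
  linarith

theorem ContainsAlmostAll.mono {S T : (n : ℕ) → Set (Fin n → Bool)} (hS : ContainsAlmostAll S)
    (h : ∀ᶠ n in atTop, S n ⊆ T n) : ContainsAlmostAll T :=
  tendsto_of_tendsto_of_tendsto_of_le_of_le' hS tendsto_const_nhds
    (h.mono fun _ hn => wordProb_mono hn) (Eventually.of_forall fun _ => wordProb_le_one _)

theorem containsAlmostAll_not_hasRepeat {d : ℝ} (hd : 2 < d) :
    ContainsAlmostAll fun n =>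
      {x : Fin n → Bool | ¬ HasRepeat x (⌊d * Real.logb 2 (n : ℝ)⌋₊ + 1)} := by
  have hlim : Tendsto (fun n : ℕ => 1 - (n : ℝ) ^ (-(d - 2))) atTop (𝓝 1) := by
    simpa using tendsto_const_nhds.sub
      ((tendsto_rpow_neg_atTop (sub_pos.mpr hd)).comp tendsto_natCast_atTop_atTop)
  refine tendsto_of_tendsto_of_tendsto_of_le_of_le' hlim tendsto_const_nhds ?_
    (Eventually.of_forall fun _ => wordProb_le_one _)
  filter_upwards [eventually_gt_atTop 0] with n hn
  have hn' : (0 : ℝ) < n := by exact_mod_cast hn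
  set m := ⌊d * Real.logb 2 (n : ℝ)⌋₊ + 1 with hm
  have hpow : (n : ℝ) ^ d ≤ 2 ^ m := by
    calc (n : ℝ) ^ d = (2 : ℝ) ^ (d * Real.logb 2 n) := by
          rw [mul_comm, Real.rpow_mul (by norm_num), Real.rpow_logb (by norm_num) (by norm_num) hn']
      _ ≤ (2 : ℝ) ^ (m : ℝ) := by
          refine Real.rpow_le_rpow_of_exponent_le (by norm_num) ?_
          rw [hm]; push_cast
          exact (Nat.lt_floor_add_one _).le
      _ = 2 ^ m := Real.rpow_natCast _ _
  have hcount : ({x : Fin n → Bool | HasRepeat x m}.ncard : ℝ) * 2 ^ m ≤ (n : ℝ) ^ 2 * 2 ^ n := by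
    exact_mod_cast ncard_hasRepeat_mul_le n m (Nat.succ_pos _)
  have hprob : wordProb {x : Fin n → Bool | HasRepeat x m} ≤ (n : ℝ) ^ (-(d - 2)) := by
    rw [neg_sub, Real.rpow_sub hn', Real.rpow_two]
    unfold wordProb
    rw [div_le_div_iff₀ (by positivity) (by positivity)]
    exact (mul_le_mul_of_nonneg_left hpow (by positivity)).trans hcount
  have := wordProb_compl {x : Fin n → Bool | HasRepeat x m}
  rw [Set.compl_ofPred] at this
  rw [this]
  linarith

/-! ### Automata with about `n / 2` states -/

/-- The walk `0, 1, …, k, k, k - 1, …, 0` of length `2 * k + 1`; its values at later times are `0`. -/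
def foldedWalk (k i : ℕ) : ℕ := if i ≤ k then i else 2 * k + 1 - i

/-- With `k = ⌊n / 2⌋`, the first `n` edges of the folded walk support only one walk of length `n`
between its end points: by parity, such a walk has to use the loop at `k`, and then it has no time
for detours. -/
theorem eq_foldedWalk {n : ℕ} (hn : 0 < n) (t : ℕ → ℕ) (h0 : t 0 = 0)
    (hlast : t n = foldedWalk (n / 2) n)
    (hstep : ∀ i < n, t (i + 1) = t i + 1 ∨ t i = t (i + 1) + 1 ∨
      (t i = n / 2 ∧ t (i + 1) = n / 2)) :
    ∀ i ≤ n, t i = foldedWalk (n / 2) i := by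
  set k := n / 2 with hk
  have hlast' : t n = 2 * k + 1 - n := by
    rw [hlast]; unfold foldedWalk; split_ifs <;> omega
  have hup : ∀ j i, i + j ≤ n → t (i + j) ≤ t i + j ∧ t i ≤ t (i + j) + j := by
    intro j i
    induction j with
    | zero => simp
    | succ j ih =>
      intro hij
      have h1 := ih (by omega)
      have h2 := hstep (i + j) (by omega)
      rw [← add_assoc]
      omega
  obtain ⟨i, hin, hi, hi'⟩ : ∃ i < n, t i = k ∧ t (i + 1) = k := by
    by_contra! hno
    have hpar : ∀ i ≤ n, t i % 2 = i % 2 := by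
      intro i
      induction i with
      | zero => simp [h0]
      | succ i ih =>
        intro hi
        have h1 := ih (by omega)
        have h2 := hstep i (by omega)
        have h3 := hno i (by omega)
        omega
    have := hpar n le_rfl
    omega
  have hik : i = k := by
    have h1 := (hup i 0 (by omega)).1
    have h2 := (hup (n - (i + 1)) (i + 1) (by omega)).2
    rw [show i + 1 + (n - (i + 1)) = n by omega] at h2
    rw [zero_add] at h1
    omega
  rw [hik] at hi hi'
  intro j hj
  unfold foldedWalk
  split_ifs with hjk
  · have h1 := (hup j 0 (by omega)).1
    have h2 := (hup (k - j) j (by omega)).1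
    rw [show j + (k - j) = k by omega] at h2
    rw [zero_add] at h1
    omega
  · have h1 := (hup (j - (k + 1)) (k + 1) (by omega)).2
    have h2 := (hup (n - j) j (by omega)).2
    rw [show k + 1 + (j - (k + 1)) = j by omega] at h1
    rw [show j + (n - j) = n by omega] at h2
    omega

theorem exists_nfa_uniquelyAccepts {α : Type*} {n : ℕ} (hn : 0 < n) (x : Fin n → α) :
    ∃ M : NFA α (Fin (n / 2 + 1)), M.UniquelyAccepts x := by
  set k := n / 2 with hk
  have hbound : ∀ i ≤ n, foldedWalk k i < k + 1 := fun i hi => by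
    unfold foldedWalk; split_ifs <;> omega
  let M : NFA α (Fin (k + 1)) :=
    { step := fun p a => {q | ∃ i : Fin n, foldedWalk k i = p ∧ foldedWalk k (i + 1) = q ∧ x i = a}
      start := {0}
      accept := {q | (q : ℕ) = foldedWalk k n} }
  refine ⟨M, ⟨0, rfl⟩, fun i => ⟨foldedWalk k i, hbound i (by omega)⟩, ⟨?_, fun i => ?_, ?_⟩, ?_⟩
  · simp [M, foldedWalk]
  · exact ⟨i, by simp, by simp, rfl⟩
  · simp [M]
  · rintro w t ⟨hstart, hstep, hacc⟩
    -- `T` extends `t` to a function on `ℕ`; its values beyond `n` play no role.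
    let T : ℕ → ℕ := fun i => if h : i < n + 1 then t ⟨i, h⟩ else 0
    have hT : ∀ i : Fin (n + 1), T i = t i := fun i => dif_pos i.isLt
    have hedge : ∀ i : Fin n, ∃ j : Fin n, foldedWalk k j = T i ∧ foldedWalk k (j + 1) = T (i + 1) ∧
        x j = w i := by
      intro i
      obtain ⟨j, h1, h2, h3⟩ := hstep i
      refine ⟨j, h1.trans (hT i.castSucc).symm, h2.trans (hT i.succ).symm, h3⟩
    have hfold := eq_foldedWalk hn T
      (by
        have h1 := hT 0
        have h2 : t 0 = 0 := hstart
        rw [h2] at h1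
        exact h1)
      ((hT (Fin.last n)).trans hacc)
      (fun i hi => by
        obtain ⟨j, h1, h2, -⟩ := hedge ⟨i, hi⟩
        simp only at h1 h2
        rw [← h1, ← h2]
        unfold foldedWalk
        split_ifs <;> omega)
    constructor
    · funext i
      obtain ⟨j, h1, h2, h3⟩ := hedge i
      rw [hfold i (by omega)] at h1
      rw [hfold (i + 1) (by omega)] at h2
      have hji : j = i := by
        have := j.isLt
        have := i.isLt
        ext
        unfold foldedWalk at h1 h2
        split_ifs at h1 h2 <;> omega
      rw [← h3, hji]
    · funext i
      ext
      rw [← hT i]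
      exact hfold i (by omega)

theorem nondetAutomaticComplexity_le {α : Type*} {n : ℕ} (hn : 0 < n) (x : Fin n → α) :
    nondetAutomaticComplexity x ≤ n / 2 + 1 :=
  Nat.sInf_le (exists_nfa_uniquelyAccepts hn x)

theorem le_two_mul_nondetAutomaticComplexity {α : Type*} {n m : ℕ} (hn : 0 < n) {x : Fin n → α}
    (hx : ¬ HasRepeat x m) : n + 1 ≤ 2 * nondetAutomaticComplexity x + (m - 1) ^ 2 := by
  have hne : {q : ℕ | ∃ M : NFA α (Fin q), M.UniquelyAccepts x}.Nonempty :=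
    ⟨_, exists_nfa_uniquelyAccepts hn x⟩
  obtain ⟨M, hM⟩ := Nat.sInf_mem hne
  obtain ⟨s, hs⟩ := hM.exists_isRigidWalk
  have := hs.card_le hx
  rwa [Fintype.card_fin] at this

/-! ### Deterministic automata -/

theorem DFA.toNFA_isAcceptingPath_iff {α σ : Type*} (M : DFA α σ) {n : ℕ} (w : Fin n → α)
    (s : Fin (n + 1) → σ) : M.toNFA.IsAcceptingPath w s ↔
      (∀ i, s i = M.eval ((List.ofFn w).take i)) ∧ List.ofFn w ∈ M.accepts := by
  have htake : ∀ i : Fin n, (List.ofFn w).take (i + 1) = (List.ofFn w).take i ++ [w i] := by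
    intro i
    rw [← List.take_concat_get' _ _ (by simp), List.getElem_ofFn]
  have hlast : (List.ofFn w).take n = List.ofFn w := List.take_of_length_le (by simp)
  constructor
  · rintro ⟨h0, hstep, hacc⟩
    have hs : ∀ i, s i = M.eval ((List.ofFn w).take i) := by
      intro i
      induction i using Fin.induction with
      | zero => simpa using h0
      | succ i ih =>
        have := hstep i
        rw [Fin.val_succ, htake, DFA.eval_append_singleton]
        rw [Fin.val_castSucc] at ih
        rw [← ih]
        exact this
    refine ⟨hs, ?_⟩
    rw [DFA.mem_accepts, ← hlast]
    exact hs (Fin.last n) ▸ hacc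
  · rintro ⟨hs, hacc⟩
    refine ⟨?_, fun i => ?_, ?_⟩
    · simp [hs]
    · simp [hs, htake]
    · rw [hs, Fin.val_last, hlast]
      exact hacc

theorem DFA.toNFA_uniquelyAccepts {α σ : Type*} {M : DFA α σ} {n : ℕ} {x : Fin n → α}
    (h : ∀ w : Fin n → α, List.ofFn w ∈ M.accepts ↔ w = x) : M.toNFA.UniquelyAccepts x := by
  refine ⟨⟨M.start, rfl⟩, fun i => M.eval ((List.ofFn x).take i), ?_, fun w t ht => ?_⟩
  · exact (M.toNFA_isAcceptingPath_iff x _).mpr ⟨fun _ => rfl, (h x).mpr rfl⟩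
  · obtain ⟨ht, hw⟩ := (M.toNFA_isAcceptingPath_iff w t).mp ht
    obtain rfl := (h w).mp hw
    exact ⟨rfl, funext ht⟩

theorem exists_dfa_accepts_iff {α : Type*} {n : ℕ} (x : Fin n → α) :
    ∃ (q : ℕ) (M : DFA α (Fin q)), ∀ w : Fin n → α, List.ofFn w ∈ M.accepts ↔ w = x := by
  -- The left quotients of `{x}` are empty or consist of a single suffix of `x`.
  have hreg : Language.IsRegular ({List.ofFn x} : Language α) := by
    refine Language.IsRegular.of_finite_range_leftQuotient (Set.Finite.subset
      (((List.ofFn x).tails.finite_toSet.image fun l => ({l} : Language α)).insert (0 : Language α)) ?_)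
    rintro _ ⟨y, rfl⟩
    by_cases h : ∃ l, y ++ l = List.ofFn x
    · obtain ⟨l, hl⟩ := h
      refine Or.inr ⟨l, (List.mem_tails _ _).mpr ⟨y, hl⟩, Set.ext fun z => ?_⟩
      change z = l ↔ y ++ z = List.ofFn x
      rw [← hl, List.append_cancel_left_eq]
    · exact Or.inl (Set.eq_empty_of_forall_notMem fun z hz => h ⟨z, hz⟩)
  obtain ⟨σ, _, M, hM⟩ := hreg
  refine ⟨Fintype.card σ, DFA.reindex (Fintype.equivFin σ) M, fun w => ?_⟩
  rw [DFA.accepts_reindex, hM]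
  exact List.ofFn_injective.eq_iff

theorem nondetAutomaticComplexity_le_automaticComplexity {α : Type*} {n : ℕ} (x : Fin n → α) :
    nondetAutomaticComplexity x ≤ automaticComplexity x := by
  have hne : {q : ℕ | ∃ M : DFA α (Fin q), ∀ w : Fin n → α,
      List.ofFn w ∈ M.accepts ↔ w = x}.Nonempty := exists_dfa_accepts_iff x
  obtain ⟨M, hM⟩ := Nat.sInf_mem hne
  exact Nat.sInf_le ⟨M.toNFA, DFA.toNFA_uniquelyAccepts hM⟩

/-! ### Asymptotics -/

theorem eventually_logb_sq_le (d : ℝ) {c : ℝ} (hc : 0 < c) :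
    ∀ᶠ n : ℕ in atTop, (d * Real.logb 2 (n : ℝ)) ^ 2 ≤ c * n := by
  have h := ((Real.isLittleO_pow_log_id_atTop (n := 2)).const_mul_left
    ((d / Real.log 2) ^ 2)).comp_tendsto (tendsto_natCast_atTop_atTop (R := ℝ))
  filter_upwards [h.bound hc] with n hn
  simp only [Function.comp_apply, id, Real.norm_eq_abs, Nat.abs_cast] at hn
  refine le_trans (le_of_eq ?_) ((le_abs_self _).trans hn)
  rw [Real.logb]
  ring

theorem containsAlmostAll_nondetAutomaticComplexity {d : ℝ} (hd : 2 < d) :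
    ContainsAlmostAll fun n =>
      {x : Fin n → Bool |
        ((n : ℝ) + 1) / 2 - 1 / 2 * (d * Real.logb 2 (n : ℝ)) ^ 2 ≤
          (nondetAutomaticComplexity x : ℝ)} := by
  refine (containsAlmostAll_not_hasRepeat hd).mono ?_
  filter_upwards [eventually_gt_atTop 0] with n hn x hx
  have h1 : (n : ℝ) + 1 ≤ 2 * nondetAutomaticComplexity x +
      (⌊d * Real.logb 2 (n : ℝ)⌋₊ : ℝ) ^ 2 := by
    exact_mod_cast le_two_mul_nondetAutomaticComplexity hn hx
  have hlog : 0 ≤ Real.logb 2 (n : ℝ) :=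
    Real.logb_nonneg (by norm_num) (by exact_mod_cast hn)
  have h2 : (⌊d * Real.logb 2 (n : ℝ)⌋₊ : ℝ) ^ 2 ≤ (d * Real.logb 2 (n : ℝ)) ^ 2 := by
    gcongr
    exact Nat.floor_le (by positivity)
  rw [Set.mem_ofPred_eq]
  linarith

theorem theorem5p1 :
    (∀ ε : ℝ, 0 < ε → ∃ n₀ : ℕ, ∀ n : ℕ, n₀ ≤ n →
      1 - ε ≤ wordProb {x : Fin n → Bool |
        |(nondetAutomaticComplexity x : ℝ) / ((n : ℝ) / 2) - 1| < ε}) ∧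
    (∀ d : ℝ, 2 < d → ContainsAlmostAll fun n =>
      {x : Fin n → Bool |
        ((n : ℝ) + 1) / 2 - 1 / 2 * (d * Real.logb 2 (n : ℝ)) ^ 2 ≤
          (nondetAutomaticComplexity x : ℝ)}) ∧
    (∀ ε : ℝ, 0 < ε → ContainsAlmostAll fun n =>
      {x : Fin n → Bool | (n : ℝ) / (2 + ε) ≤ (automaticComplexity x : ℝ)}) := by
  have h3 := containsAlmostAll_nondetAutomaticComplexity (d := 3) (by norm_num)
  refine ⟨fun ε hε => ?_, fun d hd => containsAlmostAll_nondetAutomaticComplexity hd,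
    fun ε hε => h3.mono ?_⟩
  · refine eventually_atTop.mp (Tendsto.eventually_const_le (sub_lt_self 1 hε) (h3.mono ?_))
    filter_upwards [eventually_logb_sq_le 3 (half_pos hε), eventually_gt_atTop 0,
      (tendsto_natCast_atTop_atTop (R := ℝ)).eventually_gt_atTop (2 / ε)] with n hlog hn hnε x hx
    rw [Set.mem_ofPred_eq] at hx
    have hn' : (0 : ℝ) < n := by exact_mod_cast hn
    have hup : (nondetAutomaticComplexity x : ℝ) ≤ n / 2 + 1 := by
      have h1 : (nondetAutomaticComplexity x : ℝ) ≤ ((n / 2 : ℕ) : ℝ) + 1 := by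
        exact_mod_cast nondetAutomaticComplexity_le hn x
      have h2 : ((n / 2 : ℕ) : ℝ) ≤ (n : ℝ) / 2 := by exact_mod_cast Nat.cast_div_le
      linarith
    have hεn : 2 < ε * n := by rwa [div_lt_iff₀' hε] at hnε
    rw [Set.mem_ofPred_eq, abs_lt, lt_sub_iff_add_lt, sub_lt_iff_lt_add, lt_div_iff₀ (by positivity),
      div_lt_iff₀ (by positivity)]
    constructor <;> nlinarith
  · have hc : 0 < ε / (2 + ε) := by positivity
    filter_upwards [eventually_logb_sq_le 3 hc] with n hlog x hx
    rw [Set.mem_ofPred_eq] at hx ⊢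
    have hle : (nondetAutomaticComplexity x : ℝ) ≤ automaticComplexity x := by
      exact_mod_cast nondetAutomaticComplexity_le_automaticComplexity x
    have hsplit : (n : ℝ) / (2 + ε) = n / 2 - 1 / 2 * (ε / (2 + ε) * n) := by
      field_simp
      ring
    linarith
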